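/- Let $N,I,N_{\rm pu}$ be natural numbers, $\sigma>0$, $P_{\rm sb}>0$. For every subcarrier $i=1,\dots,I$ let $\tilde{\mathbf c}_r[i]$ ($r=1,\dots,5$) be square-integrable random vectors in $\mathbb C^N$, let $\mathbf h[r,i]\in\mathbb C^N$ ($r=1,\dots,N_{\rm pu}$) be the channels to the primary users, and let $\epsilon[i]>0$, $\delta[i]>0$. Fix $\mathbf d_1,\mathbf d_2,\mathbf d_3\in\mathbb R^5$ and $\mathbf J_P\in\mathbb R^{5\times5}$, let $\mathbf e_j$ be the $j$-th unit vector of $\mathbb R^5$, and put $$\overline{\mathbf C}[i]=\sum_{j=1}^3\mathbb E\Big[\tfrac{2}{\sigma^2}\,\overline{\mathbf c}_{\mathbf d_j}[i]^*\,\overline{\mathbf c}_{\mathbf d_j}[i]^{\mathsf T}\Big],\quad \overline{\mathbf c}_{\mathbf d_j}[i]=\sum_{r=1}^5[\mathbf d_j]_r\tilde{\mathbf c}_r[i],\quad \mathbf A[i]=\tfrac12\big(\overline{\mathbf C}[i]+\overline{\mathbf C}[i]^{\mathsf H}\big),\quad \mathbf R[i]=\frac{P_{\rm sb}}{N_{\rm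 pu}}\sum_{r}\mathbf h[r,i]^*\mathbf h[r,i]^{\mathsf T}.$$ The inner problem is to minimize $$\sum_{j=1}^3\big(-\mathbf d_j^{\mathsf T}\mathbf J_P\mathbf d_j+2\mathbf d_j^{\mathsf T}\mathbf e_j\big)-\sum_{i=1}^I\Re\{\mathbf f[i]^{\mathsf H}\overline{\mathbf C}[i]\mathbf f[i]\}$$ over $\mathbf f[1],\dots,\mathbf f[I]\in\mathbb C^N$ subject to $\mathbf f[i]^{\mathsf H}\mathbf R[i]\mathbf f[i]\le\epsilon[i]$ and $\|\mathbf f[i]\|^2\le\delta[i]$ for all $i$. (0) A family $(\mathbf f[i])_i$ solves the inner problem if and only if, for each $i$, $\mathbf f[i]$ solves the subcarrier problem $\max \mathbf f^{\mathsf H}\mathbf A\mathbf f$ subject to $\mathbf f^{\mathsf H}\mathbf R\mathbf f\le\epsilon$, $\|\mathbf f\|^2\le\delta$ (with $\mathbf A=\mathbf A[i]$, and so on). For each subcarrier (index $i$ dropped; a principal unit eigenvector is a unit eigenvector for the largest eigenvalue $\lambda_{\max}$): (1) If $\lambda_{\max}(\mathbf A)\le0$, then $\mathbf f=\mathbf 0$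 is optimal. (2) If $\lambda_{\max}(\mathbf A)>0$ and $\mathbf u$ is a principal unit eigenvector of $\mathbf A$ with $\mathbf u^{\mathsf H}\mathbf R\mathbf u\le\epsilon/\delta$, then $\mathbf f=\sqrt\delta\,\mathbf u$ is optimal. (3) If $\mu>0$, $\mathbf v$ is a principal unit eigenvector of $\mathbf A-\mu\mathbf R$ with $\mathbf v^{\mathsf H}\mathbf R\mathbf v=\epsilon/\delta$, and $\mathbf R$ is singular (as it is when $N_{\rm pu}<N$) or $\lambda_{\max}(\mathbf A-\mu\mathbf R)\ge0$, then $\mathbf f=\sqrt\delta\,\mathbf v$ is optimal. (4) Let a routine be given that computes some principal unit eigenvector of every Hermitian matrix; write $\mathbf u$ and $\mathbf v(\mu)$ for its values at $\mathbf A$ and $\mathbf A-\mu\mathbf R$, and $g(\mu)=\mathbf v(\mu)^{\mathsf H}\mathbf R\mathbf v(\mu)$. Suppose that $\mathbf R$ is singular, that the principal eigenvalue of $\mathbf A-\mu\mathbf R$ is simple for every $\mu\ge0$, that $\lambda_{\max}(\mathbf A)>0$, and that $\mathbf u^{\mathsf H}\mathbf R\mathbf u>\epsilon/\delta$. Then doubling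 $\mu_u$, starting from $1$, while $g(\mu_u)>\epsilon/\delta$ stops after finitely many steps. The midpoints $\mu=(\mu_\ell+\mu_u)/2$ of the bisection that starts from $[0,\mu_u]$, and that replaces $\mu_\ell$ by $\mu$ if $g(\mu)>\epsilon/\delta$ and $\mu_u$ by $\mu$ otherwise, converge to some $\mu>0$ with $g(\mu)=\epsilon/\delta$; and $\mathbf f=\sqrt\delta\,\mathbf v(\mu)$ is optimal. (5) Consider the algorithm that returns $\mathbf 0$ if $\lambda_{\max}(\mathbf A)\le0$; else $\sqrt\delta\,\mathbf u$ if $\mathbf u^{\mathsf H}\mathbf R\mathbf u\le\epsilon/\delta$; else $\sqrt\delta\,\mathbf v(\mu)$ for the first bisection midpoint $\mu$ in (4) with $|g(\mu)-\epsilon/\delta|<\xi$. Suppose that on every subcarrier that reaches the last branch, $\mathbf R$ is singular and the principal eigenvalue of $\mathbf A-\mu\mathbf R$ is simple for every $\mu\ge0$. Then, for every tolerance $\xi>0$, the algorithm terminates on every subcarrier, and each output satisfies $\hat{\mathbf f}^{\mathsf H}\mathbf R\hat{\mathbf f}\le\epsilon+\delta\xi$ and $\|\hat{\mathbf f}\|^2\le\delta$.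 For every $\eta>0$ there is $\xi_0>0$ such that for all $0<\xi\le\xi_0$ the inner objective at the outputs is at most $\eta$ above its value at any feasible family. -/

import Mathlib

open Matrix MeasureTheory Filter Topology

noncomputable section

/-- Vectors of `ℂ^N` with the Euclidean norm. -/
abbrev CVec (N : ℕ) : Type := EuclideanSpace ℂ (Fin N)

/-- Square complex matrices of size `N`. -/
abbrev CMat (N : ℕ) : Type := Matrix (Fin N) (Fin N) ℂ

/-- `Re (f^H M f)`, which is `f^H M f` itself if `M` is Hermitian. -/
def quadRe {N : ℕ} (M : CMat N) (f : CVec N) : ℝ :=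
  (star f.ofLp ⬝ᵥ (M *ᵥ f.ofLp)).re

/-- The largest (real) eigenvalue of a Hermitian matrix. -/
def lambdaMax {N : ℕ} (M : CMat N) : ℝ :=
  sSup {t : ℝ | Module.End.HasEigenvalue (Matrix.toLin' M) (t : ℂ)}

/-- `v` is a unit eigenvector of `M` for the largest eigenvalue. -/
def IsPrincipalUnitEigenvector {N : ℕ} (M : CMat N) (v : CVec N) : Prop :=
  ‖v‖ = 1 ∧ M *ᵥ v.ofLp = (lambdaMax M : ℂ) • v.ofLp

/-- The largest eigenvalue of the Hermitian matrix `M` is simple. -/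
def HasSimplePrincipalEigenvalue {N : ℕ} (M : CMat N) : Prop :=
  Module.finrank ℂ (Module.End.eigenspace (Matrix.toLin' M) (lambdaMax M : ℂ)) = 1

/-! ### The data of the inner problem -/

/-- `c̄_d = ∑_r d_r c̃_r`, for one subcarrier. -/
def cBar {N : ℕ} {Γ : Type*} (c : Fin 5 → Γ → CVec N) (d : Fin 5 → ℝ) (γ : Γ) : CVec N :=
  ∑ r, ((d r : ℝ) : ℂ) • c r γ

/-- `C̄ = ∑_j E[(2/σ²) c̄_{d_j}^* c̄_{d_j}^T]`, for one subcarrier. -/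
def CBar {N : ℕ} {Γ : Type*} [MeasurableSpace Γ] (P : Measure Γ) (σ : ℝ)
    (c : Fin 5 → Γ → CVec N) (d : Fin 3 → Fin 5 → ℝ) : CMat N :=
  ∑ j, Matrix.of fun m n =>
    ∫ γ, ((2 / σ ^ 2 : ℝ) : ℂ) *
      Matrix.vecMulVec (star (cBar c (d j) γ).ofLp) (cBar c (d j) γ).ofLp m n ∂P

/-- `A = (C + C^H)/2`. -/
def hermPart {N : ℕ} (C : CMat N) : CMat N := (1 / 2 : ℂ) • (C + Cᴴ)

/-- `R = (P_sb / N_pu) ∑_r h_r^* h_r^T`, for one subcarrier. -/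
def RPu {N Npu : ℕ} (Psb : ℝ) (h : Fin Npu → CVec N) : CMat N :=
  ((Psb / Npu : ℝ) : ℂ) • ∑ r, Matrix.vecMulVec (star (h r).ofLp) (h r).ofLp

/-- The feasible set for one subcarrier. -/
def feasible {N : ℕ} (R : CMat N) (ε δ : ℝ) : Set (CVec N) :=
  {f | quadRe R f ≤ ε ∧ ‖f‖ ^ 2 ≤ δ}

/-- `f` solves `max f^H A f` subject to `f^H R f ≤ ε` and `‖f‖² ≤ δ`. -/
def IsSubcarrierSolution {N : ℕ} (A R : CMat N) (ε δ : ℝ) (f : CVec N) : Prop :=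
  f ∈ feasible R ε δ ∧ IsMaxOn (quadRe A) (feasible R ε δ) f

/-- The feasible set of the inner problem over all subcarriers. -/
def innerFeasible {N I : ℕ} (R : Fin I → CMat N) (ε δ : Fin I → ℝ) : Set (Fin I → CVec N) :=
  {f | ∀ i, f i ∈ feasible (R i) (ε i) (δ i)}

/-- The objective of the inner problem,
`∑_j (-d_j^T J_P d_j + 2 d_j^T e_j) - ∑_i Re (f[i]^H C̄[i] f[i])`. -/
def innerObjective {N I : ℕ} (JP : Matrix (Fin 5) (Fin 5) ℝ) (d : Fin 3 → Fin 5 → ℝ)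
    (C : Fin I → CMat N) (f : Fin I → CVec N) : ℝ :=
  ∑ j : Fin 3, (-(d j ⬝ᵥ (JP *ᵥ d j))
      + 2 * (d j ⬝ᵥ Pi.single (Fin.castLE (by norm_num : 3 ≤ 5) j) (1 : ℝ)))
    - ∑ i, quadRe (C i) (f i)

/-- `f` solves the inner problem (a minimization). -/
def IsInnerSolution {N I : ℕ} (JP : Matrix (Fin 5) (Fin 5) ℝ) (d : Fin 3 → Fin 5 → ℝ)
    (C R : Fin I → CMat N) (ε δ : Fin I → ℝ) (f : Fin I → CVec N) : Prop :=
  f ∈ innerFeasible R ε δ ∧ IsMinOn (innerObjective JP d C) (innerFeasible R ε δ) f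

/-! ### The algorithm -/

/-- A routine that computes some principal unit eigenvector of every Hermitian matrix. -/
def IsEigRoutine {N : ℕ} (eig : CMat N → CVec N) : Prop :=
  ∀ M : CMat N, M.IsHermitian → IsPrincipalUnitEigenvector M (eig M)

/-- `g(μ) = v(μ)^H R v(μ)`, with `v(μ)` the computed principal unit eigenvector of `A - μ R`. -/
def gFun {N : ℕ} (eig : CMat N → CVec N) (A R : CMat N) (μ : ℝ) : ℝ :=
  quadRe R (eig (A - (μ : ℂ) • R))

/-- The loop "`μᵤ ← 1`; while `g(μᵤ) > t` do `μᵤ ← 2 μᵤ`" ends with the value `μᵤ`. -/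
def DoublingReturns (g : ℝ → ℝ) (t μᵤ : ℝ) : Prop :=
  ∃ k : ℕ, μᵤ = 2 ^ k ∧ g (2 ^ k) ≤ t ∧ ∀ m < k, t < g (2 ^ m)

/-- The midpoint of a bracket. -/
def bracketMid (s : ℝ × ℝ) : ℝ := (s.1 + s.2) / 2

/-- One bisection step on a bracket `(μₗ, μᵤ)`. -/
def bisectStep (g : ℝ → ℝ) (t : ℝ) (s : ℝ × ℝ) : ℝ × ℝ :=
  if t < g (bracketMid s) then (bracketMid s, s.2) else (s.1, bracketMid s)

/-- The `k`-th midpoint `μ` evaluated by the bisection that starts from `(0, μᵤ)`. -/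
def bisectMid (g : ℝ → ℝ) (t μᵤ : ℝ) (k : ℕ) : ℝ :=
  bracketMid ((bisectStep g t)^[k] (0, μᵤ))

/-- The bisection that starts from `(0, μᵤ)` and stops as soon as `|g(μ) - t| < ξ` ends with
the value `μ`. -/
def BisectionReturns (g : ℝ → ℝ) (t ξ μᵤ μ : ℝ) : Prop :=
  ∃ k : ℕ, μ = bisectMid g t μᵤ k ∧ |g (bisectMid g t μᵤ k) - t| < ξ ∧
    ∀ m < k, ξ ≤ |g (bisectMid g t μᵤ m) - t|

/-- The algorithm, run with the tolerance `ξ`, terminates and returns `f`. -/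
inductive AlgorithmReturns {N : ℕ} (eig : CMat N → CVec N) (A R : CMat N) (ε δ ξ : ℝ) :
    CVec N → Prop
  | zero : lambdaMax A ≤ 0 → AlgorithmReturns eig A R ε δ ξ 0
  | principal : 0 < lambdaMax A → quadRe R (eig A) ≤ ε / δ →
      AlgorithmReturns eig A R ε δ ξ ((Real.sqrt δ : ℂ) • eig A)
  | bisection (μᵤ μ : ℝ) : 0 < lambdaMax A → ε / δ < quadRe R (eig A) →
      DoublingReturns (gFun eig A R) (ε / δ) μᵤ →
      BisectionReturns (gFun eig A R) (ε / δ) ξ μᵤ μ →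
      AlgorithmReturns eig A R ε δ ξ ((Real.sqrt δ : ℂ) • eig (A - (μ : ℂ) • R))

/-- `R` has a nontrivial kernel. -/
def HasKernel {N : ℕ} (R : CMat N) : Prop := ∃ f : CVec N, f ≠ 0 ∧ R *ᵥ f.ofLp = 0

/-- The principal eigenvalue of `A - μ R` is simple for every `μ ≥ 0`. -/
def NonDegenerate {N : ℕ} (A R : CMat N) : Prop :=
  ∀ μ : ℝ, 0 ≤ μ → HasSimplePrincipalEigenvalue (A - (μ : ℂ) • R)

end

/-! The objective is a constant minus a sum over subcarriers and the constraint set is a product, so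
the problem decouples; `hermPart` leaves the real quadratic form unchanged. On one subcarrier
everything is Lagrangian duality. If `μ ≥ 0` and `λ_max(A - μR) ≥ 0`, the Rayleigh bound
`quadRe_le_lambdaMax` gives `f^H A f ≤ δ λ_max(A - μR) + μ ε` on the feasible set. A scaled
principal eigenvector of `A - μR` attains this bound under complementary slackness
(`isSubcarrierSolution_of_complementary`). The search for `μ` rests on `A` being positive
semidefinite. A kernel vector of `R` then forces `λ_max(A - μR) ≥ 0`, whence `μ g(μ) ≤ λ_max(A)` and
doubling stops. Simplicity of the principal eigenvalue makes `g` continuous on `μ ≥ 0`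
(`tendsto_gFun`), so bisection converges to a root. Stopping early costs at most `δ μ ξ`, and `μ` is
bounded by the doubling value, which does not depend on `ξ`. -/

/-! ### Quadratic forms. -/

section QuadRe

open scoped ComplexOrder

variable {N : ℕ}

lemma quadRe_hermPart (C : CMat N) (f : CVec N) : quadRe (hermPart C) f = quadRe C f := by
  have h : star (star f.ofLp ⬝ᵥ (C *ᵥ f.ofLp)) = star f.ofLp ⬝ᵥ (Cᴴ *ᵥ f.ofLp) := by
    rw [star_dotProduct, star_star, star_mulVec, dotProduct_mulVec]
  have h' := congrArg Complex.re h
  rw [Complex.star_def, Complex.conj_re] at h'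
  unfold quadRe hermPart
  rw [smul_mulVec, add_mulVec, dotProduct_smul, dotProduct_add, smul_eq_mul,
    show (1 / 2 : ℂ) = ((1 / 2 : ℝ) : ℂ) by norm_num, Complex.re_ofReal_mul, Complex.add_re, ← h']
  ring

lemma quadRe_sub_smul (A R : CMat N) (μ : ℝ) (f : CVec N) :
    quadRe (A - (μ : ℂ) • R) f = quadRe A f - μ * quadRe R f := by
  unfold quadRe
  rw [sub_mulVec, smul_mulVec, dotProduct_sub, dotProduct_smul, smul_eq_mul, Complex.sub_re,
    Complex.re_ofReal_mul]

lemma quadRe_smul (M : CMat N) (z : ℂ) (f : CVec N) :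
    quadRe M (z • f) = ‖z‖ ^ 2 * quadRe M f := by
  unfold quadRe
  rw [WithLp.ofLp_smul, star_smul, mulVec_smul, dotProduct_smul, smul_dotProduct, smul_eq_mul,
    smul_eq_mul, ← mul_assoc, Complex.star_def, Complex.mul_conj, Complex.re_ofReal_mul,
    Complex.normSq_eq_norm_sq]

lemma quadRe_sqrt_smul (M : CMat N) {δ : ℝ} (hδ : 0 ≤ δ) (f : CVec N) :
    quadRe M ((Real.sqrt δ : ℂ) • f) = δ * quadRe M f := by
  rw [quadRe_smul, Complex.norm_real, Real.norm_eq_abs, sq_abs, Real.sq_sqrt hδ]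

lemma norm_sqrt_smul_sq {δ : ℝ} (hδ : 0 ≤ δ) {f : CVec N} (hf : ‖f‖ = 1) :
    ‖(Real.sqrt δ : ℂ) • f‖ ^ 2 = δ := by
  rw [norm_smul, hf, mul_one, Complex.norm_real, Real.norm_eq_abs, sq_abs, Real.sq_sqrt hδ]

@[simp] lemma quadRe_zero (M : CMat N) : quadRe M 0 = 0 := by simp [quadRe]

lemma continuous_quadRe (M : CMat N) : Continuous (quadRe M) := by
  unfold quadRe dotProduct mulVec dotProduct
  simp only [Pi.star_apply]
  fun_prop

lemma star_dotProduct_self_eq (f : CVec N) :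
    star f.ofLp ⬝ᵥ f.ofLp = ((‖f‖ ^ 2 : ℝ) : ℂ) := by
  rw [dotProduct_comm, ← EuclideanSpace.inner_eq_star_dotProduct, inner_self_eq_norm_sq_to_K]
  simp

lemma quadRe_of_mulVec_eq {M : CMat N} {f : CVec N} {t : ℝ}
    (h : M *ᵥ f.ofLp = (t : ℂ) • f.ofLp) : quadRe M f = t * ‖f‖ ^ 2 := by
  rw [quadRe, h, dotProduct_smul, star_dotProduct_self_eq, smul_eq_mul, ← Complex.ofReal_mul,
    Complex.ofReal_re]

lemma Matrix.PosSemidef.quadRe_nonneg {M : CMat N} (hM : M.PosSemidef) (f : CVec N) :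
    0 ≤ quadRe M f :=
  (Complex.le_def.1 (hM.dotProduct_mulVec_nonneg f.ofLp)).1

end QuadRe

/-! ### The largest eigenvalue, and continuity of `g`. -/

section LambdaMax

open scoped ComplexOrder

variable {N : ℕ}

lemma le_lambdaMax {M : CMat N} {t : ℝ}
    (ht : Module.End.HasEigenvalue (Matrix.toLin' M) (t : ℂ)) : t ≤ lambdaMax M := by
  refine le_csSup (Set.Finite.bddAbove ?_) ht
  exact (Module.End.finite_hasEigenvalue (Matrix.toLin' M)).preimage
    Complex.ofReal_injective.injOn

/-- An eigenvalue `ν` of `L • 1 - M` makes `L - ν` an eigenvalue of `M`, so `L - ν ≤ L` and `L • 1 -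
M` is positive semidefinite. For `N = 0` both sides vanish. -/
lemma quadRe_le_lambdaMax {M : CMat N} (hM : M.IsHermitian) (f : CVec N) :
    quadRe M f ≤ lambdaMax M * ‖f‖ ^ 2 := by
  set L := lambdaMax M with hL
  have hH : ((L : ℂ) • (1 : CMat N) - M).IsHermitian := by
    refine IsHermitian.sub ?_ hM
    rw [IsHermitian, conjTranspose_smul, conjTranspose_one, Complex.star_def, Complex.conj_ofReal]
  have hpos : ((L : ℂ) • (1 : CMat N) - M).PosSemidef := by
    rw [hH.posSemidef_iff_eigenvalues_nonneg]
    intro j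
    have he := hH.mulVec_eigenvectorBasis j
    have hne : (hH.eigenvectorBasis j).ofLp ≠ 0 := by
      intro h0
      have : hH.eigenvectorBasis j = 0 := by ext k; exact congrFun h0 k
      simpa [this] using hH.eigenvectorBasis.norm_eq_one j
    have : Module.End.HasEigenvalue (Matrix.toLin' M) ((L - hH.eigenvalues j : ℝ) : ℂ) := by
      refine Module.End.hasEigenvalue_of_hasEigenvector (x := (hH.eigenvectorBasis j).ofLp)
        (Module.End.hasEigenvector_iff.2 ⟨Module.End.mem_eigenspace_iff.2 ?_, hne⟩)
      rw [sub_mulVec, smul_mulVec, one_mulVec] at he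
      rw [Matrix.toLin'_apply, Complex.ofReal_sub, sub_smul, Complex.coe_smul (hH.eigenvalues j),
        ← he]
      abel
    have := le_lambdaMax this
    show 0 ≤ hH.eigenvalues j
    linarith
  have h0 := hpos.quadRe_nonneg f
  have h1 : quadRe ((L : ℂ) • (1 : CMat N) - M) f = L * ‖f‖ ^ 2 - quadRe M f := by
    rw [quadRe, sub_mulVec, smul_mulVec, one_mulVec, dotProduct_sub, dotProduct_smul,
      star_dotProduct_self_eq, Complex.sub_re, smul_eq_mul, ← Complex.ofReal_mul,
      Complex.ofReal_re]
    rfl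
  linarith

lemma IsPrincipalUnitEigenvector.quadRe_eq {M : CMat N} {v : CVec N}
    (hv : IsPrincipalUnitEigenvector M v) : quadRe M v = lambdaMax M := by
  rw [quadRe_of_mulVec_eq hv.2, hv.1]; ring

lemma isHermitian_sub_smul {A R : CMat N} (hA : A.IsHermitian) (hR : R.IsHermitian) (μ : ℝ) :
    (A - (μ : ℂ) • R).IsHermitian := by
  refine hA.sub ?_
  rw [IsHermitian, conjTranspose_smul, hR.eq, Complex.star_def, Complex.conj_ofReal]

/-- At a kernel vector of `R` the form of `A - μR` equals that of `A`, which is nonnegative. This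
supplies the sign condition of weak duality. -/
lemma lambdaMax_sub_smul_nonneg {A R : CMat N} (hA : A.PosSemidef) (hR : R.IsHermitian)
    (hK : HasKernel R) (μ : ℝ) : 0 ≤ lambdaMax (A - (μ : ℂ) • R) := by
  obtain ⟨f, hf, hRf⟩ := hK
  have h := quadRe_le_lambdaMax (isHermitian_sub_smul hA.1 hR μ) f
  have hq : quadRe R f = 0 := by simp [quadRe, hRf]
  rw [quadRe_sub_smul, hq, mul_zero, sub_zero] at h
  have hn : 0 < ‖f‖ ^ 2 := by have := norm_pos_iff.2 hf; positivity
  exact nonneg_of_mul_nonneg_left ((hA.quadRe_nonneg f).trans h) hn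

/-- All principal unit eigenvectors have the same quadratic forms if the eigenvalue is simple. -/
lemma HasSimplePrincipalEigenvalue.quadRe_eq {M : CMat N} (hM : HasSimplePrincipalEigenvalue M)
    {v w : CVec N} (hv : IsPrincipalUnitEigenvector M v) (hw : IsPrincipalUnitEigenvector M w)
    (R : CMat N) : quadRe R w = quadRe R v := by
  have hvne : v.ofLp ≠ 0 := by
    intro h0
    have : v = 0 := by ext k; exact congrFun h0 k
    simpa [this] using hv.1
  -- `v` spans the eigenspace, so `w` differs from it by a phase, which quadratic forms ignore.
  obtain ⟨z, hz⟩ := (finrank_eq_one_iff_of_nonzero'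
    (⟨v.ofLp, Module.End.mem_eigenspace_iff.2 (by rw [Matrix.toLin'_apply, hv.2])⟩ :
      Module.End.eigenspace (Matrix.toLin' M) (lambdaMax M : ℂ))
    (by simpa [Subtype.ext_iff] using hvne)).1 hM
    ⟨w.ofLp, Module.End.mem_eigenspace_iff.2 (by rw [Matrix.toLin'_apply, hw.2])⟩
  have hzw : w = z • v := by
    ext k; exact (congrFun (congrArg Subtype.val hz) k).symm
  have hz1 : ‖z‖ = 1 := by
    have := hw.1
    rwa [hzw, norm_smul, hv.1, mul_one] at this
  rw [hzw, quadRe_smul, hz1]; ring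

/-- The quadratic form of `R` at the principal eigenvector of `A - μ R` depends continuously on
`μ`, as long as the principal eigenvalue is simple. -/
lemma tendsto_gFun {eig : CMat N → CVec N} (he : IsEigRoutine eig) {A R : CMat N}
    (hA : A.IsHermitian) (hR : R.IsHermitian) {μ : ℝ}
    (hs : HasSimplePrincipalEigenvalue (A - (μ : ℂ) • R)) {x : ℕ → ℝ}
    (hx : Tendsto x atTop (𝓝 μ)) :
    Tendsto (fun n => gFun eig A R (x n)) atTop (𝓝 (gFun eig A R μ)) := by
  have hev : ∀ s : ℝ, IsPrincipalUnitEigenvector (A - (s : ℂ) • R) (eig (A - (s : ℂ) • R)) :=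
    fun s => he _ (isHermitian_sub_smul hA hR s)
  -- `eig` itself need not be continuous. By compactness of the sphere its values converge along a
  -- further subsequence, and it suffices that the limit `w` is a principal eigenvector at `μ`.
  refine tendsto_of_subseq_tendsto fun ns hns => ?_
  obtain ⟨w, hw, φ, hφ, hlim⟩ := (isCompact_sphere (0 : CVec N) 1).tendsto_subseq
    (x := fun n => eig (A - (x (ns n) : ℂ) • R)) (fun n => by simpa using (hev _).1)
  refine ⟨φ, ?_⟩
  have hxl : Tendsto (fun n => x (ns (φ n))) atTop (𝓝 μ) :=
    hx.comp (hns.comp hφ.tendsto_atTop)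
  have hq : ∀ M : CMat N, Tendsto (fun n => quadRe M (eig (A - (x (ns (φ n)) : ℂ) • R))) atTop
      (𝓝 (quadRe M w)) := fun M => ((continuous_quadRe M).tendsto w).comp hlim
  have hL : Tendsto (fun n => lambdaMax (A - (x (ns (φ n)) : ℂ) • R)) atTop
      (𝓝 (quadRe (A - (μ : ℂ) • R) w)) := by
    rw [quadRe_sub_smul]
    refine ((hq A).sub (hxl.mul (hq R))).congr fun n => ?_
    rw [← (hev _).quadRe_eq, quadRe_sub_smul]
  have hw1 : ‖w‖ = 1 := by simpa using hw
  have hmax : quadRe (A - (μ : ℂ) • R) w = lambdaMax (A - (μ : ℂ) • R) := by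
    refine le_antisymm ?_ ?_
    · simpa [hw1] using quadRe_le_lambdaMax (isHermitian_sub_smul hA hR μ) w
    -- The fixed vector `eig (A - μR)` is a competitor in every Rayleigh bound along the sequence;
    -- the comparison survives the limit.
    · rw [← (hev μ).quadRe_eq]
      have h2 : Tendsto (fun n => quadRe (A - (x (ns (φ n)) : ℂ) • R) (eig (A - (μ : ℂ) • R)))
          atTop (𝓝 (quadRe (A - (μ : ℂ) • R) (eig (A - (μ : ℂ) • R)))) := by
        simp only [quadRe_sub_smul]
        exact tendsto_const_nhds.sub (hxl.mul_const _)
      refine le_of_tendsto_of_tendsto' h2 hL fun n => ?_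
      have := quadRe_le_lambdaMax (isHermitian_sub_smul hA hR (x (ns (φ n))))
        (eig (A - (μ : ℂ) • R))
      rwa [(hev μ).1, one_pow, mul_one] at this
  have hcoord : Tendsto (fun n => (eig (A - (x (ns (φ n)) : ℂ) • R)).ofLp) atTop (𝓝 w.ofLp) :=
    ((PiLp.continuous_ofLp 2 _).tendsto w).comp hlim
  have hxc : Tendsto (fun n => (x (ns (φ n)) : ℂ)) atTop (𝓝 (μ : ℂ)) :=
    (Complex.continuous_ofReal.tendsto μ).comp hxl
  have hLc : Tendsto (fun n => (lambdaMax (A - (x (ns (φ n)) : ℂ) • R) : ℂ)) atTop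
      (𝓝 (lambdaMax (A - (μ : ℂ) • R) : ℂ)) :=
    (Complex.continuous_ofReal.tendsto _).comp (hmax ▸ hL)
  have hmv : ∀ M : CMat N, Continuous fun y : Fin N → ℂ => M *ᵥ y := fun M =>
    continuous_const.matrix_mulVec continuous_id
  have heq : (A - (μ : ℂ) • R) *ᵥ w.ofLp = (lambdaMax (A - (μ : ℂ) • R) : ℂ) • w.ofLp := by
    refine tendsto_nhds_unique ?_ (hLc.smul hcoord)
    rw [sub_mulVec, smul_mulVec]
    refine ((((hmv A).tendsto _).comp hcoord).sub
      (hxc.smul (((hmv R).tendsto _).comp hcoord))).congr fun n => ?_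
    rw [← (hev _).2, sub_mulVec, smul_mulVec]
    rfl
  have := hq R
  -- Simplicity at `μ` makes the limit independent of the subsequence.
  rwa [hs.quadRe_eq (hev μ) ⟨hw1, heq⟩ R] at this

end LambdaMax

/-! ### Positive semidefiniteness of the data matrices. -/

section Data

open scoped ComplexOrder

variable {N : ℕ}

lemma RPu_posSemidef {Npu : ℕ} {Psb : ℝ} (hP : 0 ≤ Psb) (h : Fin Npu → CVec N) :
    (RPu Psb h).PosSemidef := by
  refine PosSemidef.smul (posSemidef_sum _ fun r _ => posSemidef_vecMulVec_star_self _) ?_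
  rw [Complex.zero_le_real]
  -- This includes `Npu = 0`, where the quotient is `0` by convention.
  positivity

lemma memLp_cBar {Γ : Type*} [MeasurableSpace Γ] {P : Measure Γ} {c : Fin 5 → Γ → CVec N}
    (hc : ∀ r, MemLp (c r) 2 P) (d : Fin 5 → ℝ) : MemLp (cBar c d) 2 P := by
  have : cBar c d = ∑ r, ((d r : ℝ) : ℂ) • c r := by
    ext γ; simp [cBar]
  rw [this]
  exact memLp_finsetSum' _ fun r _ => (hc r).const_smul _

lemma integrable_vecMulVec {Γ : Type*} [MeasurableSpace Γ] {P : Measure Γ} {g : Γ → CVec N}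
    (hg : MemLp g 2 P) (m n : Fin N) :
    Integrable (fun γ => Matrix.vecMulVec (star (g γ).ofLp) (g γ).ofLp m n) P := by
  have hcoord : ∀ k, MemLp (fun γ => (g γ).ofLp k) 2 P := fun k =>
    (PiLp.proj 2 (fun _ : Fin N => ℂ) k : CVec N →L[ℂ] ℂ).comp_memLp' hg
  have := (hcoord n).integrable_mul (hcoord m).star
  refine this.congr (ae_of_all _ fun γ => ?_)
  simp [vecMulVec_apply, mul_comm]

/-- Each summand has the form `x ↦ E[(2/σ²) |c̄^T x|²]`. Square integrability makes the matrix
entries integrable, so the expectation may be exchanged with the finite sums. -/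
lemma CBar_posSemidef {Γ : Type*} [MeasurableSpace Γ] {P : Measure Γ} (σ : ℝ)
    {c : Fin 5 → Γ → CVec N} (hc : ∀ r, MemLp (c r) 2 P) (d : Fin 3 → Fin 5 → ℝ) :
    (CBar P σ c d).PosSemidef := by
  refine posSemidef_sum _ fun j _ => ?_
  have hint := integrable_vecMulVec (memLp_cBar hc (d j))
  refine .of_dotProduct_mulVec_nonneg ?_ fun x => ?_
  · ext m n
    simp only [conjTranspose_apply, of_apply, Complex.star_def, ← integral_conj]
    refine integral_congr_ae (ae_of_all _ fun γ => ?_)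
    simp only [map_mul, Complex.conj_ofReal]
    simp [vecMulVec_apply, mul_comm]
  · have h1 : star x ⬝ᵥ ((of fun m n => ∫ γ, ((2 / σ ^ 2 : ℝ) : ℂ) *
        vecMulVec (star (cBar c (d j) γ).ofLp) (cBar c (d j) γ).ofLp m n ∂P) *ᵥ x)
        = ∫ γ, ((2 / σ ^ 2 * ‖(cBar c (d j) γ).ofLp ⬝ᵥ x‖ ^ 2 : ℝ) : ℂ) ∂P := by
      simp only [dotProduct, mulVec, of_apply, Pi.star_apply, Finset.mul_sum]
      have hi : ∀ m n, Integrable (fun γ => star (x m) * (((2 / σ ^ 2 : ℝ) : ℂ) *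
          vecMulVec (star (cBar c (d j) γ).ofLp) (cBar c (d j) γ).ofLp m n * x n)) P :=
        fun m n => (((hint m n).const_mul _).mul_const _).const_mul _
      have : ∀ γ, ((2 / σ ^ 2 * ‖∑ i, (cBar c (d j) γ).ofLp i * x i‖ ^ 2 : ℝ) : ℂ)
          = ∑ m, ∑ n, star (x m) * (((2 / σ ^ 2 : ℝ) : ℂ) *
          vecMulVec (star (cBar c (d j) γ).ofLp) (cBar c (d j) γ).ofLp m n * x n) := by
        intro γ
        rw [Complex.ofReal_mul, Complex.ofReal_pow, ← Complex.conj_mul', map_sum,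
          Finset.sum_mul_sum, Finset.mul_sum]
        refine Finset.sum_congr rfl fun m _ => ?_
        rw [Finset.mul_sum]
        refine Finset.sum_congr rfl fun n _ => ?_
        simp only [map_mul, vecMulVec_apply, Pi.star_apply, Complex.star_def]
        ring
      simp only [this]
      rw [integral_finsetSum _ fun m _ => integrable_finsetSum _ fun n _ => hi m n]
      refine Finset.sum_congr rfl fun m _ => ?_
      rw [integral_finsetSum _ fun n _ => hi m n]
      refine Finset.sum_congr rfl fun n _ => ?_
      simp only [integral_const_mul, integral_mul_const]
    rw [h1, integral_complex_ofReal, Complex.zero_le_real]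
    exact integral_nonneg fun γ => by positivity

lemma Matrix.PosSemidef.hermPart_eq {C : CMat N} (hC : C.PosSemidef) : hermPart C = C := by
  rw [hermPart, hC.1.eq, ← two_smul ℂ C, smul_smul]; norm_num

end Data

/-! ### Doubling and bisection for a real function. -/

section Bisection

/-- Hence the initial bracket, and with it the constant in the loss bound, does not depend on the
tolerance. -/
lemma DoublingReturns.unique {g : ℝ → ℝ} {t a b : ℝ} (ha : DoublingReturns g t a)
    (hb : DoublingReturns g t b) : a = b := by
  obtain ⟨k, rfl, hk, hk'⟩ := ha
  obtain ⟨l, rfl, hl, hl'⟩ := hb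
  rcases lt_trichotomy k l with h | h | h
  · exact absurd (hl' k h) hk.not_gt
  · rw [h]
  · exact absurd (hk' l h) hl.not_gt

/-- If `g x > t` at some `x = 2 ^ k > B / t`, then `x * g x > B`. -/
lemma exists_doublingReturns {g : ℝ → ℝ} {t B : ℝ} (ht : 0 < t)
    (hB : ∀ x, 0 ≤ x → x * g x ≤ B) : ∃ μᵤ, DoublingReturns g t μᵤ := by
  classical
  have hex : ∃ k : ℕ, g (2 ^ k) ≤ t := by
    obtain ⟨k, hk⟩ := pow_unbounded_of_one_lt (B / t) (one_lt_two : (1 : ℝ) < 2)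
    refine ⟨k, ?_⟩
    by_contra! hlt
    have hp : (0 : ℝ) < 2 ^ k := by positivity
    have h1 := hB _ hp.le
    rw [div_lt_iff₀ ht] at hk
    nlinarith
  exact ⟨_, Nat.find hex, rfl, Nat.find_spec hex, fun m hm => not_le.1 (Nat.find_min hex hm)⟩

variable {g : ℝ → ℝ} {t μᵤ : ℝ}

/-- The ends stay on opposite sides of the level `t`, whether or not `g` is monotone. -/
lemma bisect_invariant (h0 : t < g 0) (hu : g μᵤ ≤ t) (hμ : 0 ≤ μᵤ) (k : ℕ) :
    let s := (bisectStep g t)^[k] (0, μᵤ)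
    0 ≤ s.1 ∧ s.2 ≤ μᵤ ∧ t < g s.1 ∧ g s.2 ≤ t ∧ s.2 - s.1 = μᵤ / 2 ^ k := by
  induction k with
  | zero => simp [h0, hu]
  | succ k ih =>
    simp only [Function.iterate_succ_apply']
    obtain ⟨h1, h2, h3, h4, h5⟩ := ih
    set s := (bisectStep g t)^[k] (0, μᵤ)
    have hw : 0 ≤ μᵤ / 2 ^ k := by positivity
    have hp : μᵤ / 2 ^ (k + 1) = μᵤ / 2 ^ k / 2 := by rw [pow_succ, div_div]
    unfold bisectStep
    split_ifs with h <;> simp only [bracketMid] at h ⊢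
    · exact ⟨by linarith, h2, h, h4, by rw [hp]; linarith⟩
    · exact ⟨h1, by linarith, h3, not_lt.1 h, by rw [hp]; linarith⟩

lemma bisectMid_mem (h0 : t < g 0) (hu : g μᵤ ≤ t) (hμ : 0 ≤ μᵤ) (k : ℕ) :
    0 ≤ bisectMid g t μᵤ k ∧ bisectMid g t μᵤ k ≤ μᵤ := by
  obtain ⟨h1, h2, -, -, h5⟩ := bisect_invariant h0 hu hμ k
  have hw : 0 ≤ μᵤ / 2 ^ k := by positivity
  unfold bisectMid bracketMid
  constructor <;> linarith

/-- Both ends converge to one point `μ`; the lower ends give `g μ ≥ t` and the upper ends `g μ ≤ t`.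
Continuity is asked for only at `y ≥ 0`, where simplicity of the eigenvalue is available. -/
lemma tendsto_bisectMid (h0 : t < g 0) (hu : g μᵤ ≤ t) (hμ : 0 ≤ μᵤ)
    (hg : ∀ y, 0 ≤ y → ∀ x : ℕ → ℝ, Tendsto x atTop (𝓝 y) →
      Tendsto (fun n => g (x n)) atTop (𝓝 (g y))) :
    ∃ μ, 0 < μ ∧ Tendsto (bisectMid g t μᵤ) atTop (𝓝 μ) ∧ g μ = t := by
  have inv := bisect_invariant h0 hu hμ
  set s : ℕ → ℝ × ℝ := fun k => (bisectStep g t)^[k] (0, μᵤ) with hs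
  have hmono : Monotone fun k => (s k).1 := by
    refine monotone_nat_of_le_succ fun k => ?_
    have h5 := (inv k).2.2.2.2
    have hw : 0 ≤ μᵤ / 2 ^ k := by positivity
    have hle : (s k).1 ≤ bracketMid (s k) := by
      unfold bracketMid; simp only [hs]; linarith
    simp only [hs, Function.iterate_succ_apply'] at hle ⊢
    rw [bisectStep]
    split_ifs
    · exact hle
    · exact le_rfl
  have hbdd : BddAbove (Set.range fun k => (s k).1) := by
    refine ⟨μᵤ, ?_⟩
    rintro _ ⟨k, rfl⟩
    have hw : 0 ≤ μᵤ / 2 ^ k := by positivity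
    have := inv k
    simp only [hs]
    linarith [this.2.1, this.2.2.2.2]
  have hlow := tendsto_atTop_ciSup hmono hbdd
  set μ := ⨆ k, (s k).1
  have hwidth : Tendsto (fun k : ℕ => μᵤ / 2 ^ k) atTop (𝓝 0) :=
    tendsto_const_nhds.div_atTop (tendsto_pow_atTop_atTop_of_one_lt one_lt_two)
  have hup : Tendsto (fun k => (s k).2) atTop (𝓝 μ) := by
    have := hlow.add hwidth
    rw [add_zero] at this
    refine this.congr fun k => ?_
    have := (inv k).2.2.2.2
    simp only [hs]; linarith
  have hμ0 : 0 ≤ μ := ge_of_tendsto' hlow fun k => (inv k).1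
  have hgμ : g μ = t := le_antisymm
    (le_of_tendsto' (hg μ hμ0 _ hup) fun k => (inv k).2.2.2.1)
    (ge_of_tendsto' (hg μ hμ0 _ hlow) fun k => (inv k).2.2.1.le)
  refine ⟨μ, lt_of_le_of_ne hμ0 ?_, ?_, hgμ⟩
  · rintro h
    rw [← h] at hgμ
    exact h0.ne' hgμ
  · have := (hlow.add hup).div_const 2
    rwa [add_self_div_two] at this

lemma exists_bisectionReturns {ξ : ℝ} (hξ : 0 < ξ)
    (h : Tendsto (fun k => g (bisectMid g t μᵤ k)) atTop (𝓝 t)) :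
    ∃ ν, BisectionReturns g t ξ μᵤ ν := by
  classical
  have hex : ∃ k, |g (bisectMid g t μᵤ k) - t| < ξ := by
    obtain ⟨k, hk⟩ := (Metric.tendsto_atTop.1 h ξ hξ)
    exact ⟨k, by simpa [Real.dist_eq] using hk k le_rfl⟩
  exact ⟨_, Nat.find hex, rfl, Nat.find_spec hex, fun m hm => not_lt.1 (Nat.find_min hex hm)⟩

end Bisection

/-! ### Duality and the algorithm on one subcarrier. -/

section Subcarrier

open scoped ComplexOrder

variable {N : ℕ} {A R : CMat N} {ε δ : ℝ}

/-- Weak duality for the subcarrier problem. -/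
lemma quadRe_le_of_mem_feasible (hA : A.IsHermitian) (hR : R.IsHermitian) {μ : ℝ} (hμ : 0 ≤ μ)
    (hL : 0 ≤ lambdaMax (A - (μ : ℂ) • R)) {f : CVec N} (hf : f ∈ feasible R ε δ) :
    quadRe A f ≤ lambdaMax (A - (μ : ℂ) • R) * δ + μ * ε := by
  have h := quadRe_le_lambdaMax (isHermitian_sub_smul hA hR μ) f
  rw [quadRe_sub_smul] at h
  have h1 := mul_le_mul_of_nonneg_left hf.1 hμ
  have h2 := mul_le_mul_of_nonneg_left hf.2 hL
  linarith

lemma IsPrincipalUnitEigenvector.quadRe_sqrt_smul_eq (hδ : 0 ≤ δ) {μ : ℝ} {v : CVec N}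
    (hv : IsPrincipalUnitEigenvector (A - (μ : ℂ) • R) v) :
    quadRe A ((Real.sqrt δ : ℂ) • v) =
      δ * lambdaMax (A - (μ : ℂ) • R) + δ * (μ * quadRe R v) := by
  have h := hv.quadRe_eq
  rw [quadRe_sub_smul] at h
  rw [quadRe_sqrt_smul _ hδ, ← h]
  ring

lemma isSubcarrierSolution_zero (hA : A.IsHermitian) (hε : 0 ≤ ε) (hδ : 0 ≤ δ)
    (hL : lambdaMax A ≤ 0) : IsSubcarrierSolution A R ε δ 0 := by
  refine ⟨⟨by simpa using hε, by simpa using hδ⟩, fun f _ => ?_⟩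
  show quadRe A f ≤ quadRe A 0
  rw [quadRe_zero]
  exact (quadRe_le_lambdaMax hA f).trans (mul_nonpos_of_nonpos_of_nonneg hL (by positivity))

/-- The vector attains the dual bound. Slackness is multiplied by `μ` so that `μ = 0` covers an
inactive interference constraint. -/
lemma isSubcarrierSolution_of_complementary (hA : A.IsHermitian) (hR : R.IsHermitian)
    (hδ : 0 < δ) {μ : ℝ} (hμ : 0 ≤ μ) (hL : 0 ≤ lambdaMax (A - (μ : ℂ) • R)) {v : CVec N}
    (hv : IsPrincipalUnitEigenvector (A - (μ : ℂ) • R) v) (hle : quadRe R v ≤ ε / δ)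
    (hcs : μ * quadRe R v = μ * (ε / δ)) :
    IsSubcarrierSolution A R ε δ ((Real.sqrt δ : ℂ) • v) := by
  refine ⟨⟨?_, (norm_sqrt_smul_sq hδ.le hv.1).le⟩, fun f hf => ?_⟩
  · rw [quadRe_sqrt_smul _ hδ.le]
    rwa [le_div_iff₀' hδ] at hle
  · show quadRe A f ≤ quadRe A ((Real.sqrt δ : ℂ) • v)
    rw [hv.quadRe_sqrt_smul_eq hδ.le, hcs]
    refine (quadRe_le_of_mem_feasible hA hR hμ hL hf).trans_eq ?_
    field_simp

lemma isSubcarrierSolution_principal (hA : A.IsHermitian) (hR : R.IsHermitian)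
    (hδ : 0 < δ) (hL : 0 ≤ lambdaMax A) {u : CVec N} (hu : IsPrincipalUnitEigenvector A u)
    (hle : quadRe R u ≤ ε / δ) : IsSubcarrierSolution A R ε δ ((Real.sqrt δ : ℂ) • u) := by
  have h0 : A - ((0 : ℝ) : ℂ) • R = A := by simp
  exact isSubcarrierSolution_of_complementary hA hR hδ le_rfl (by rwa [h0]) (by rwa [h0]) hle
    (by simp)

variable {eig : CMat N → CVec N}

lemma gFun_zero : gFun eig A R 0 = quadRe R (eig A) := by simp [gFun]

/-- With `v` the computed eigenvector, `μ g(μ) = v^H A v - λ_max(A - μR)`; the first term is at most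
`λ_max(A)` and the subtracted one is nonnegative. -/
lemma mul_gFun_le (he : IsEigRoutine eig) (hA : A.PosSemidef) (hR : R.IsHermitian)
    (hK : HasKernel R) (μ : ℝ) : μ * gFun eig A R μ ≤ lambdaMax A := by
  have hv := he _ (isHermitian_sub_smul hA.1 hR μ)
  have h1 := hv.quadRe_eq
  rw [quadRe_sub_smul] at h1
  have h2 := quadRe_le_lambdaMax hA.1 (eig (A - (μ : ℂ) • R))
  rw [hv.1] at h2
  have h3 := lambdaMax_sub_smul_nonneg hA hR hK μ
  unfold gFun
  linarith

lemma doubling_and_bisection_converge (he : IsEigRoutine eig) (hA : A.PosSemidef)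
    (hR : R.IsHermitian) (hε : 0 < ε) (hδ : 0 < δ) (hK : HasKernel R) (hnd : NonDegenerate A R)
    (hu : ε / δ < quadRe R (eig A)) :
    ∃ μᵤ : ℝ, DoublingReturns (gFun eig A R) (ε / δ) μᵤ ∧
      ∃ μ : ℝ, 0 < μ ∧ Tendsto (bisectMid (gFun eig A R) (ε / δ) μᵤ) atTop (𝓝 μ) ∧
        gFun eig A R μ = ε / δ ∧
        Tendsto (fun k => gFun eig A R (bisectMid (gFun eig A R) (ε / δ) μᵤ k)) atTop
          (𝓝 (ε / δ)) := by
  obtain ⟨μᵤ, hd⟩ := exists_doublingReturns (g := gFun eig A R) (div_pos hε hδ)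
    fun x _ => mul_gFun_le he hA hR hK x
  have hcont : ∀ y, 0 ≤ y → ∀ x : ℕ → ℝ, Tendsto x atTop (𝓝 y) →
      Tendsto (fun n => gFun eig A R (x n)) atTop (𝓝 (gFun eig A R y)) :=
    fun y hy x hx => tendsto_gFun he hA.1 hR (hnd y hy) hx
  obtain ⟨k, hk, hgk, -⟩ := id hd
  obtain ⟨μ, hμ, hlim, hg⟩ := tendsto_bisectMid (gFun_zero.symm ▸ hu) (hk ▸ hgk)
    (hk ▸ by positivity) hcont
  exact ⟨μᵤ, hd, μ, hμ, hlim, hg, by simpa only [hg] using hcont μ hμ.le _ hlim⟩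

lemma exists_algorithmReturns (he : IsEigRoutine eig) (hA : A.PosSemidef) (hR : R.IsHermitian)
    (hε : 0 < ε) (hδ : 0 < δ)
    (hlast : 0 < lambdaMax A → ε / δ < quadRe R (eig A) → HasKernel R ∧ NonDegenerate A R)
    {ξ : ℝ} (hξ : 0 < ξ) : ∃ f, AlgorithmReturns eig A R ε δ ξ f := by
  rcases le_or_gt (lambdaMax A) 0 with hL | hL
  · exact ⟨_, .zero hL⟩
  rcases le_or_gt (quadRe R (eig A)) (ε / δ) with hu | hu
  · exact ⟨_, .principal hL hu⟩
  obtain ⟨hK, hnd⟩ := hlast hL hu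
  obtain ⟨μᵤ, hd, -, -, -, -, hlim⟩ := doubling_and_bisection_converge he hA hR hε hδ hK hnd hu
  obtain ⟨ν, hν⟩ := exists_bisectionReturns hξ hlim
  exact ⟨_, .bisection μᵤ ν hL hu hd hν⟩

lemma AlgorithmReturns.almost_feasible (he : IsEigRoutine eig) (hA : A.IsHermitian)
    (hR : R.IsHermitian) (hε : 0 < ε) (hδ : 0 < δ) {ξ : ℝ} (hξ : 0 < ξ) {f : CVec N}
    (hf : AlgorithmReturns eig A R ε δ ξ f) : quadRe R f ≤ ε + δ * ξ ∧ ‖f‖ ^ 2 ≤ δ := by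
  have hpos : 0 < δ * ξ := mul_pos hδ hξ
  cases hf with
  | zero _ => exact ⟨by rw [quadRe_zero]; linarith, by simpa using hδ.le⟩
  | principal _ hu =>
    refine ⟨?_, (norm_sqrt_smul_sq hδ.le (he _ hA).1).le⟩
    rw [quadRe_sqrt_smul _ hδ.le]
    rw [le_div_iff₀' hδ] at hu
    linarith
  | bisection μᵤ μ _ _ _ hb =>
    refine ⟨?_, (norm_sqrt_smul_sq hδ.le (he _ (isHermitian_sub_smul hA hR μ)).1).le⟩
    obtain ⟨k, rfl, hk, -⟩ := hb
    rw [quadRe_sqrt_smul _ hδ.le]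
    have h1 : gFun eig A R (bisectMid (gFun eig A R) (ε / δ) μᵤ k) ≤ ε / δ + ξ := by
      linarith [(abs_lt.1 hk).2]
    have h2 := mul_le_mul_of_nonneg_left h1 hδ.le
    rwa [mul_add, mul_div_cancel₀ _ hδ.ne'] at h2

/-- The loss of the algorithm is at most proportional to the tolerance. -/
lemma exists_algorithm_loss_le (he : IsEigRoutine eig) (hA : A.PosSemidef) (hR : R.IsHermitian)
    (hε : 0 < ε) (hδ : 0 < δ)
    (hlast : 0 < lambdaMax A → ε / δ < quadRe R (eig A) → HasKernel R ∧ NonDegenerate A R) :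
    ∃ K : ℝ, 0 ≤ K ∧ ∀ ξ, 0 < ξ → ∀ F, AlgorithmReturns eig A R ε δ ξ F →
      ∀ f ∈ feasible R ε δ, quadRe A f ≤ quadRe A F + K * ξ := by
  -- `K` bounds every multiplier that bisection can visit; if doubling never returns, `0` serves
  -- vacuously.
  have hex : ∃ K : ℝ, 0 ≤ K ∧ ∀ μᵤ, DoublingReturns (gFun eig A R) (ε / δ) μᵤ → μᵤ ≤ K := by
    by_cases h : ∃ a, DoublingReturns (gFun eig A R) (ε / δ) a
    · obtain ⟨a, ha⟩ := h
      obtain ⟨k, hk, -⟩ := id ha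
      exact ⟨a, hk ▸ by positivity, fun b hb => (hb.unique ha).le⟩
    · exact ⟨0, le_rfl, fun b hb => absurd ⟨b, hb⟩ h⟩
  obtain ⟨K, hK, hKb⟩ := hex
  refine ⟨δ * K, by positivity, fun ξ hξ F hF f hf => ?_⟩
  have hpos : 0 ≤ δ * K * ξ := by positivity
  cases hF with
  | zero hL =>
    have := (isSubcarrierSolution_zero (R := R) hA.1 hε.le hδ.le hL).2 hf
    exact le_add_of_le_of_nonneg this hpos
  | principal hL hu =>
    have := (isSubcarrierSolution_principal hA.1 hR hδ hL.le (he _ hA.1) hu).2 hf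
    exact le_add_of_le_of_nonneg this hpos
  | bisection μᵤ μ hL hu hd hb =>
    have hker := (hlast hL hu).1
    have hμu := hKb _ hd
    obtain ⟨l, hl, hgl, -⟩ := hd
    obtain ⟨k, rfl, hk, -⟩ := hb
    obtain ⟨hμ0, hμ1⟩ := bisectMid_mem (gFun_zero.symm ▸ hu) (hl ▸ hgl) (hl ▸ by positivity) k
    set μ := bisectMid (gFun eig A R) (ε / δ) μᵤ k
    have hdual := quadRe_le_of_mem_feasible hA.1 hR hμ0
      (lambdaMax_sub_smul_nonneg hA hR hker μ) hf
    -- The dual bound exceeds the attained value by `δ μ (ε/δ - g(μ))`, at most `δ K ξ`.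
    rw [(he _ (isHermitian_sub_smul hA.1 hR μ)).quadRe_sqrt_smul_eq hδ.le]
    have h1 : ε / δ - ξ ≤ quadRe R (eig (A - (μ : ℂ) • R)) := by
      have := (abs_lt.1 hk).1
      unfold gFun at this
      linarith
    have h2 := mul_le_mul_of_nonneg_left (mul_le_mul_of_nonneg_left h1 hμ0) hδ.le
    have h3 : δ * (μ * (ε / δ - ξ)) = μ * ε - δ * μ * ξ := by field_simp
    have h4 : δ * μ * ξ ≤ δ * K * ξ := by gcongr; exact hμ1.trans hμu
    linarith

lemma CBar_hermPart_posSemidef {Γ : Type*} [MeasurableSpace Γ] {P : Measure Γ} (σ : ℝ)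
    {c : Fin 5 → Γ → CVec N} (hc : ∀ r, MemLp (c r) 2 P) (d : Fin 3 → Fin 5 → ℝ) :
    (hermPart (CBar P σ c d)).PosSemidef := by
  rw [(CBar_posSemidef σ hc d).hermPart_eq]
  exact CBar_posSemidef σ hc d

end Subcarrier

/-! ### Decoupling and the main theorem. -/

/-- Minimizing the inner objective amounts to solving every subcarrier problem. -/
lemma isInnerSolution_iff {N I : ℕ} {JP : Matrix (Fin 5) (Fin 5) ℝ} {d : Fin 3 → Fin 5 → ℝ}
    {C R : Fin I → CMat N} {ε δ : Fin I → ℝ} (f : Fin I → CVec N) :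
    IsInnerSolution JP d C R ε δ f ↔
      ∀ i, IsSubcarrierSolution (hermPart (C i)) (R i) (ε i) (δ i) (f i) := by
  constructor
  · refine fun ⟨hf, hmin⟩ i => ⟨hf i, fun x hx => ?_⟩
    show quadRe (hermPart (C i)) x ≤ quadRe (hermPart (C i)) (f i)
    rw [quadRe_hermPart, quadRe_hermPart]
    -- Changing a single block keeps feasibility and isolates one term of the sum.
    have hmem : Function.update f i x ∈ innerFeasible R ε δ := by
      intro j
      rcases eq_or_ne j i with rfl | hj
      · simpa using hx
      · simpa [hj] using hf j
    have h : innerObjective JP d C f ≤ innerObjective JP d C (Function.update f i x) := hmin hmem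
    unfold innerObjective at h
    have hs := sub_le_sub_iff_left _ |>.1 h
    rw [← Finset.add_sum_erase _ _ (Finset.mem_univ i),
      ← Finset.add_sum_erase _ (fun j => quadRe (C j) (f j)) (Finset.mem_univ i),
      Function.update_self, Finset.sum_congr rfl fun j hj => by
        rw [Function.update_of_ne (Finset.ne_of_mem_erase hj)]] at hs
    linarith
  · refine fun h => ⟨fun i => (h i).1, fun x hx => ?_⟩
    show innerObjective JP d C f ≤ innerObjective JP d C x
    refine sub_le_sub_left (Finset.sum_le_sum fun i _ => ?_) _
    have : quadRe (hermPart (C i)) (x i) ≤ quadRe (hermPart (C i)) (f i) := (h i).2 (hx i)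
    simpa only [quadRe_hermPart] using this

theorem proposition2 {N I Npu : ℕ}
    -- the law of the unknown state, the noise level, the derivative vectors and the fixed `d_j`
    {Γ : Type*} [MeasurableSpace Γ] (P : Measure Γ) [IsProbabilityMeasure P]
    (σ : ℝ) (hσ : 0 < σ)
    (c : Fin I → Fin 5 → Γ → CVec N) (hc : ∀ i r, MemLp (c i r) 2 P)
    (d : Fin 3 → Fin 5 → ℝ) (JP : Matrix (Fin 5) (Fin 5) ℝ)
    -- the transmit power, the channels to the primary users, the budgets
    (Psb : ℝ) (hPsb : 0 < Psb) (h : Fin I → Fin Npu → CVec N)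
    (ε δ : Fin I → ℝ) (hε : ∀ i, 0 < ε i) (hδ : ∀ i, 0 < δ i)
    -- the matrices `C̄[i]`, `A[i]`, `R[i]`
    (C A R : Fin I → CMat N) (hC : ∀ i, C i = CBar P σ (c i) d)
    (hA : ∀ i, A i = hermPart (C i)) (hR : ∀ i, R i = RPu Psb (h i)) :
    -- the inner problem decouples over the subcarriers
    (∀ f : Fin I → CVec N, IsInnerSolution JP d C R ε δ f ↔
      ∀ i, IsSubcarrierSolution (A i) (R i) (ε i) (δ i) (f i)) ∧
    -- first case
    (∀ i, lambdaMax (A i) ≤ 0 → IsSubcarrierSolution (A i) (R i) (ε i) (δ i) 0) ∧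
    -- second case
    (∀ i, ∀ u : CVec N, 0 < lambdaMax (A i) → IsPrincipalUnitEigenvector (A i) u →
      quadRe (R i) u ≤ ε i / δ i →
      IsSubcarrierSolution (A i) (R i) (ε i) (δ i) ((Real.sqrt (δ i) : ℂ) • u)) ∧
    -- third case: optimality
    (∀ i, ∀ μ : ℝ, 0 < μ → (HasKernel (R i) ∨ 0 ≤ lambdaMax (A i - (μ : ℂ) • R i)) →
      ∀ v : CVec N, IsPrincipalUnitEigenvector (A i - (μ : ℂ) • R i) v → quadRe (R i) v = ε i / δ i →
      IsSubcarrierSolution (A i) (R i) (ε i) (δ i) ((Real.sqrt (δ i) : ℂ) • v)) ∧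
    -- third case: the multiplier exists and is the limit of the bisection
    (∀ eig : CMat N → CVec N, IsEigRoutine eig → ∀ i, HasKernel (R i) →
      NonDegenerate (A i) (R i) → 0 < lambdaMax (A i) →
      ε i / δ i < quadRe (R i) (eig (A i)) →
      ∃ μᵤ : ℝ, DoublingReturns (gFun eig (A i) (R i)) (ε i / δ i) μᵤ ∧
        ∃ μ : ℝ, 0 < μ ∧
          Tendsto (bisectMid (gFun eig (A i) (R i)) (ε i / δ i) μᵤ) atTop (𝓝 μ) ∧
          gFun eig (A i) (R i) μ = ε i / δ i ∧
          IsSubcarrierSolution (A i) (R i) (ε i) (δ i)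
            ((Real.sqrt (δ i) : ℂ) • eig (A i - (μ : ℂ) • R i))) ∧
    -- the algorithm with a positive tolerance, on all subcarriers
    (∀ eig : CMat N → CVec N, IsEigRoutine eig →
      (∀ i, 0 < lambdaMax (A i) → ε i / δ i < quadRe (R i) (eig (A i)) →
        HasKernel (R i) ∧ NonDegenerate (A i) (R i)) →
      (∀ ξ : ℝ, 0 < ξ → ∀ i, ∃ f, AlgorithmReturns eig (A i) (R i) (ε i) (δ i) ξ f) ∧
      (∀ ξ : ℝ, 0 < ξ → ∀ i f, AlgorithmReturns eig (A i) (R i) (ε i) (δ i) ξ f →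
        quadRe (R i) f ≤ ε i + δ i * ξ ∧ ‖f‖ ^ 2 ≤ δ i) ∧
      (∀ η : ℝ, 0 < η → ∃ ξ₀ : ℝ, 0 < ξ₀ ∧ ∀ ξ : ℝ, 0 < ξ → ξ ≤ ξ₀ →
        ∀ F : Fin I → CVec N,
          (∀ i, AlgorithmReturns eig (A i) (R i) (ε i) (δ i) ξ (F i)) →
          ∀ f ∈ innerFeasible R ε δ,
            innerObjective JP d C F ≤ innerObjective JP d C f + η)) := by
  have hApos := fun i => CBar_hermPart_posSemidef σ (hc i) d
  simp only [← hC, ← hA] at hApos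
  have hRH : ∀ i, (R i).IsHermitian := fun i => hR i ▸ (RPu_posSemidef hPsb.le (h i)).1
  refine ⟨fun f => ?_, fun i hL => ?_, fun i u hL hu hle => ?_, fun i μ hμ hor v hv hq => ?_,
    fun eig he i hK hnd hL hu => ?_, fun eig he hlast => ⟨fun ξ hξ i => ?_,
    fun ξ hξ i f hf => ?_, fun η hη => ?_⟩⟩
  · simp only [hA]
    exact isInnerSolution_iff f
  · exact isSubcarrierSolution_zero (hApos i).1 (hε i).le (hδ i).le hL
  · exact isSubcarrierSolution_principal (hApos i).1 (hRH i) (hδ i) hL.le hu hle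
  · exact isSubcarrierSolution_of_complementary (hApos i).1 (hRH i) (hδ i) hμ.le
      (hor.elim (fun hK => lambdaMax_sub_smul_nonneg (hApos i) (hRH i) hK μ) id) hv hq.le
      (by rw [hq])
  · obtain ⟨μᵤ, hd, μ, hμ, hlim, hg, -⟩ :=
      doubling_and_bisection_converge he (hApos i) (hRH i) (hε i) (hδ i) hK hnd hu
    exact ⟨μᵤ, hd, μ, hμ, hlim, hg, isSubcarrierSolution_of_complementary (hApos i).1 (hRH i)
      (hδ i) hμ.le (lambdaMax_sub_smul_nonneg (hApos i) (hRH i) hK μ)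
      (he _ (isHermitian_sub_smul (hApos i).1 (hRH i) μ)) hg.le (congrArg (μ * ·) hg)⟩
  · exact exists_algorithmReturns he (hApos i) (hRH i) (hε i) (hδ i) (hlast i) hξ
  · exact hf.almost_feasible he (hApos i).1 (hRH i) (hε i) (hδ i) hξ
  · choose K hK hloss using fun i =>
      exists_algorithm_loss_le he (hApos i) (hRH i) (hε i) (hδ i) (hlast i)
    have hsum : 0 ≤ ∑ i, K i := Finset.sum_nonneg fun i _ => hK i
    -- The losses add up to `(∑ K i) ξ`; the `+ 1` keeps the denominator positive when all `K i`
    -- vanish.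
    refine ⟨η / (∑ i, K i + 1), by positivity, fun ξ hξ hξ₀ F hF f hf => ?_⟩
    have hle : ∑ i, quadRe (C i) (f i) ≤ ∑ i, (quadRe (C i) (F i) + K i * ξ) := by
      refine Finset.sum_le_sum fun i _ => ?_
      have := hloss i ξ hξ (F i) (hF i) (f i) (hf i)
      rwa [hA, quadRe_hermPart, quadRe_hermPart] at this
    rw [Finset.sum_add_distrib, ← Finset.sum_mul] at hle
    rw [le_div_iff₀ (by positivity)] at hξ₀
    unfold innerObjective
    nlinarith
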